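/- Let $n\ge 3$ and let $W_n$ be the wheel graph: the cycle graph on the vertices $1,\dots,n$ (in clockwise order), together with a sink $0$ adjacent to all of them. A configuration $c=(c_1,\dots,c_n)\in\mathbb{Z}_{\ge 0}^n$ is stable if $c_i<\deg(i)=3$ for all $i\in[n]$, i.e. if $c\in\{0,1,2\}^n$; a vertex $i \in [n]$ with $c_i\ge\deg(i)$ is unstable. Fix a probability distribution $\mu$ on $[n]$ with $\mu_i>0$ for all $i$, and $p\in(0,1)$. In the Abelian sandpile model (ASM), an unstable vertex topples by sending one grain to each of its neighbours. In the stochastic sandpile model (SSM), when an unstable vertex topples, each neighbour independently receives one grain from it with probability $p$ (and otherwise that grain stays), independently of all other topplings. In both models, grains sent to the sink disappear. In both models consider the Markov chain on stable configurations in which each step adds one grain at a vertex chosen (independently) according to $\mu$ and then topples unstable vertices until a stable configuration is reached (almost surely this happens, and the result does not depend on the order of topplings). A stable configuration $c$ is recurrent if the chain started from $c$ almost surely visits $c$ infinitely often; let $\mathrm{ASMRec}(W_n)$ and $\mathrm{SSMRec}(W_n)$ be the sets of recurrent configurations. For $i,j\in[n]$ let $(i,j)$ be the clockwise open interval from $i$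 to $j$, that is $\{i+1,\dots,j-1\}$ if $i<j$ and $\{i+1,\dots,n\}\cup\{1,\dots,j-1\}$ if $i>j$; by convention, $(i,i):=[n]\setminus\{i\}$. Let $c\in\{0,1,2\}^n$ be a stable configuration on $W_n$. 1. $c$ is recurrent for the SSM if and only if for all $i,j\in[n]$ (possibly $i=j$) with $c_i=c_j=0$ there exists $k\in(i,j)$ with $c_k=2$. 2. $c$ is recurrent for the ASM if and only if it is recurrent for the SSM and there exists $i\in[n]$ with $c_i=2$. Consequently, $\mathrm{SSMRec}(W_n)=\mathrm{ASMRec}(W_n)\cup\{(1,1,\dots,1)\}$. -/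

import Mathlib

namespace Sandpile

/-! Graphs have vertex set `Option (Fin n)`: the vertex `none` is the sink (written `0` in the usual
notation), and `some 0, …, some (n - 1)` are the non-sink vertices `1, …, n`.
A configuration is a map `c : Fin n → ℕ`; the sink carries no grains. -/

/-- The wheel graph: the join of the cycle graph on `n` vertices and of a single vertex, the
sink. -/
def wheelGraph (n : ℕ) : SimpleGraph (Option (Fin n)) where
  Adj
    | none, none => False
    | none, some _ => True
    | some _, none => True
    | some i, some j => (SimpleGraph.cycleGraph n).Adj i j
  symm := ⟨by
    rintro (_ | i) (_ | j) h
    · exact h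
    · trivial
    · trivial
    · exact SimpleGraph.Adj.symm h⟩
  loopless := ⟨by
    rintro (_ | i) h
    · exact h
    · exact (SimpleGraph.cycleGraph n).irrefl h⟩

instance (n : ℕ) : DecidableRel (wheelGraph n).Adj
  | none, none => inferInstanceAs (Decidable False)
  | none, some _ => inferInstanceAs (Decidable True)
  | some _, none => inferInstanceAs (Decidable True)
  | some i, some j => inferInstanceAs (Decidable ((SimpleGraph.cycleGraph n).Adj i j))

/-- A configuration is stable if every non-sink vertex has fewer grains than its degree. -/
def IsStable {n : ℕ} (G : SimpleGraph (Option (Fin n))) [DecidableRel G.Adj]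
    (c : Fin n → ℕ) : Prop :=
  ∀ i, c i < G.degree (some i)

/-- The configuration obtained from `c` when the vertex `i` sends one grain to each vertex of the
set `A` (a set of neighbours of `i`, so that `i ∉ A`); grains sent to the sink are lost. -/
def sendGrains {n : ℕ} (i : Fin n) (A : Finset (Option (Fin n))) (c : Fin n → ℕ) : Fin n → ℕ :=
  fun j => if j = i then c j - A.card else c j + (if some j ∈ A then 1 else 0)

/-- One legal toppling. The states are pairs `(c, u)` of a configuration `c` and the record `u` of
how many times each vertex has toppled so far. An unstable vertex `i` topples; if it has already
toppled `u i` times, then it sends one grain to each vertex of `I i (u i)`. So `I i k` is the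
(possibly random) set of neighbours that receive a grain in the `k`-th toppling of `i`,
`k = 0, 1, …`. -/
def ToppleStep {n : ℕ} (G : SimpleGraph (Option (Fin n))) [DecidableRel G.Adj]
    (I : Fin n → ℕ → Finset (Option (Fin n))) (s t : (Fin n → ℕ) × (Fin n → ℕ)) : Prop :=
  ∃ i, G.degree (some i) ≤ s.1 i ∧
    t = (sendGrains i (I i (s.2 i)) s.1, Function.update s.2 i (s.2 i + 1))

/-- `d` is a stabilisation of `c`: a stable configuration reached from `c` by finitely many legal
topplings, performed in any order. -/
def IsStabilisation {n : ℕ} (G : SimpleGraph (Option (Fin n))) [DecidableRel G.Adj]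
    (I : Fin n → ℕ → Finset (Option (Fin n))) (c d : Fin n → ℕ) : Prop :=
  ∃ u, Relation.ReflTransGen (ToppleStep G I) (c, fun _ => 0) (d, u) ∧ IsStable G d

/-- The stabilisation does not depend on the order of the topplings. -/
theorem IsStabilisation.unique {n : ℕ} {G : SimpleGraph (Option (Fin n))} [DecidableRel G.Adj]
    {I : Fin n → ℕ → Finset (Option (Fin n))} (hI : ∀ i k, I i k ⊆ G.neighborFinset (some i))
    {c d e : Fin n → ℕ} (hd : IsStabilisation G I c d) (he : IsStabilisation G I c e) :
    d = e := by
  obtain ⟨u, hu, hsd⟩ := hd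
  obtain ⟨v, hv, hse⟩ := he
  have hcard : ∀ i k, (I i k).card ≤ G.degree (some i) := fun i k =>
    (Finset.card_le_card (hI i k)).trans_eq (G.card_neighborFinset_eq_degree _)
  have hfin : ∀ (d : Fin n → ℕ) (u : Fin n → ℕ), IsStable G d →
      ∀ t, Relation.ReflTransGen (ToppleStep G I) (d, u) t → t = (d, u) := by
    intro d u hs t ht
    rcases Relation.ReflTransGen.cases_head ht with h | ⟨w, ⟨i, hi, -⟩, -⟩
    · exact h.symm
    · exact absurd hi (not_le.mpr (hs i))
  obtain ⟨t, h1, h2⟩ := Relation.church_rosser (r := ToppleStep G I) (by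
    rintro ⟨a, w⟩ b b' ⟨i, hi, rfl⟩ ⟨j, hj, rfl⟩
    by_cases hij : i = j
    · subst hij
      exact ⟨_, Relation.ReflGen.refl, Relation.ReflTransGen.refl⟩
    · have hji : ¬ j = i := fun h => hij h.symm
      refine ⟨_, Relation.ReflGen.single ⟨j, ?_, rfl⟩,
        Relation.ReflTransGen.single ⟨i, ?_, ?_⟩⟩
      · simp only [sendGrains, if_neg hji]
        exact hj.trans (Nat.le_add_right _ _)
      · simp only [sendGrains, if_neg hij]
        exact hi.trans (Nat.le_add_right _ _)
      · have e1 := hcard i (w i)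
        have e2 := hcard j (w j)
        simp only at hi hj
        refine Prod.ext ?_ ?_
        · funext k
          simp only [sendGrains, Function.update_of_ne hij, Function.update_of_ne hji]
          by_cases hki : k = i
          · subst hki
            simp only [if_neg hij, if_true]
            omega
          · by_cases hkj : k = j
            · subst hkj
              simp only [if_neg hki, if_true]
              omega
            · simp only [if_neg hki, if_neg hkj]
              omega
        · simp only [Function.update_of_ne hij, Function.update_of_ne hji]
          exact Function.update_comm hij _ _ _) hu hv
  have := (hfin d u hsd t h1).symm.trans (hfin e v hse t h2)
  exact congrArg Prod.fst this

open Classical in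
/-- The stabilisation of `c`. It is unique whenever it exists, by `IsStabilisation.unique`. The
last clause only serves to make the function total: on a connected graph a stabilisation always
exists in the Abelian model, and it exists almost surely in the stochastic model. -/
noncomputable def stabilise {n : ℕ} (G : SimpleGraph (Option (Fin n))) [DecidableRel G.Adj]
    (I : Fin n → ℕ → Finset (Option (Fin n))) (c : Fin n → ℕ) : Fin n → ℕ :=
  if h : ∃ d, IsStabilisation G I c d then h.choose else c

/-- The path of the sandpile chain started from `c`: at time `t`, one grain is added at the vertex
`v t`, and the result is stabilised with the toppling instructions `I t`. -/
noncomputable def chain {n : ℕ} (G : SimpleGraph (Option (Fin n))) [DecidableRel G.Adj]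
    (v : ℕ → Fin n) (I : ℕ → Fin n → ℕ → Finset (Option (Fin n))) (c : Fin n → ℕ) :
    ℕ → (Fin n → ℕ)
  | 0 => c
  | t + 1 => stabilise G (I t) (chain G v I c t + Pi.single (v t) 1)

/-- Abelian topplings: every neighbour receives a grain. -/
def asmInstr {n : ℕ} (G : SimpleGraph (Option (Fin n))) [DecidableRel G.Adj] :
    ℕ → Fin n → ℕ → Finset (Option (Fin n)) :=
  fun _ i _ => G.neighborFinset (some i)

/-- Stochastic topplings: in the `k`-th toppling of `i` at time `t`, a neighbour `j` receives a
grain if the coin `ξ (t, i, k, j)` shows `true`. -/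
def ssmInstr {n : ℕ} (G : SimpleGraph (Option (Fin n))) [DecidableRel G.Adj]
    (ξ : ℕ × Fin n × ℕ × Option (Fin n) → Bool) :
    ℕ → Fin n → ℕ → Finset (Option (Fin n)) :=
  fun t i k => (G.neighborFinset (some i)).filter fun j => ξ (t, i, k, j) = true

/-- The law of the sequence of vertices where grains are added: independent, each distributed
according to `μ`. -/
noncomputable def grainLaw {n : ℕ} (μ : PMF (Fin n)) : MeasureTheory.Measure (ℕ → Fin n) :=
  MeasureTheory.Measure.infinitePi fun _ => μ.toMeasure

/-- The law of the coins: independent, each showing `true` with probability `p` and `false` with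
probability `1 - p`. -/
noncomputable def coinLaw (n : ℕ) (p : unitInterval) :
    MeasureTheory.Measure (ℕ × Fin n × ℕ × Option (Fin n) → Bool) :=
  MeasureTheory.Measure.infinitePi fun _ => ProbabilityTheory.bernoulliMeasure true false p

/-- Recurrent configurations of the Abelian sandpile model: the stable configurations to which the
chain started from them almost surely returns infinitely often. -/
def ASMRec {n : ℕ} (G : SimpleGraph (Option (Fin n))) [DecidableRel G.Adj]
    (μ : PMF (Fin n)) : Set (Fin n → ℕ) :=
  {c | IsStable G c ∧
    ∀ᵐ v ∂(grainLaw μ), ∃ᶠ t in Filter.atTop, chain G v (asmInstr G) c t = c}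

/-- Recurrent configurations of the stochastic sandpile model with parameter `p`: the stable
configurations to which the chain started from them almost surely returns infinitely often. The
coins are independent of the positions of the added grains. -/
def SSMRec {n : ℕ} (G : SimpleGraph (Option (Fin n))) [DecidableRel G.Adj]
    (μ : PMF (Fin n)) (p : unitInterval) : Set (Fin n → ℕ) :=
  {c | IsStable G c ∧
    ∀ᵐ ω ∂((grainLaw μ).prod (coinLaw n p)),
      ∃ᶠ t in Filter.atTop, chain G ω.1 (ssmInstr G ω.2) c t = c}

/-- The clockwise open interval from `i` to `j` on the cycle with vertices in clockwise order. By
convention, for `i = j` it consists of all vertices other than `i`. -/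
def openArc {n : ℕ} (i j : Fin n) : Set (Fin n) :=
  if i = j then {i}ᶜ else if i < j then Set.Ioo i j else Set.Ioi i ∪ Set.Iio j

end Sandpile

/-! Every stable configuration can be filled up to the maximal one, $(2,\dots,2)$, by adding grains,
so a stable configuration is recurrent exactly when it can be reached from $(2,\dots,2)$. What
remains is to find that reachable set.

Upper bound, by invariants. `Oriented` holds at $(2,\dots,2)$ and survives added grains and every
toppling, complete or partial: when a vertex sends a grain along a cycle edge, turn that edge
towards the receiver. For stable configurations it forces a 2 between any two zeros
(`Oriented.zerosSeparated`). `Burnable` survives only complete topplings and, applied to the whole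
cycle, forces a 2 somewhere; this is what distinguishes the Abelian model.

Lower bound, by Dhar's burning algorithm. Separated zeros together with a 2 imply `Burnable`
(`ZerosSeparated.burnable`), and then $c+\mathbf 1$ topples to $c$, every vertex firing once. Hence
$\mathbf 2+c=(c+\mathbf 1)+\mathbf 1$ topples to $c$, so adding $c$ to $(2,\dots,2)$ leads to $c$
(`Burnable.exists_run_two_eq`). The only configuration with separated zeros and no 2 is
$(1,\dots,1)$; one partial toppling reaches it from a burnable configuration (`exists_next_eq_one`).

Probability enters through finite words of additions with prescribed topplings. Each prescribed
toppling loses a grain to the sink, so a word fixes finitely many coins and has positive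
probability. One word visits $c$ from every stable start; by the second Borel–Cantelli lemma it
occurs in infinitely many disjoint time blocks. Conversely, with positive probability the chain from
$c$ starts by climbing to $(2,\dots,2)$, after which the invariants hold forever, so a recurrent $c$
satisfies them. -/

namespace Sandpile

open Finset Filter

/-! ### Existence and invariants of stabilisation on a general graph. -/

section General

variable {n : ℕ} {G : SimpleGraph (Option (Fin n))} [DecidableRel G.Adj]

theorem some_notMem_of_subset {A : Finset (Option (Fin n))} {i : Fin n}
    (hA : A ⊆ G.neighborFinset (some i)) : some i ∉ A := fun h => by
  simpa using hA h

theorem card_le_degree_of_subset {A : Finset (Option (Fin n))} {i : Fin n}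
    (hA : A ⊆ G.neighborFinset (some i)) : A.card ≤ G.degree (some i) :=
  (card_le_card hA).trans_eq (G.card_neighborFinset_eq_degree _)

/-- A toppling preserves the number of grains, counting those that fall into the sink. -/
theorem sum_sendGrains {i : Fin n} {A : Finset (Option (Fin n))} {c : Fin n → ℕ}
    (hi : some i ∉ A) (hA : A.card ≤ c i) :
    ∑ j, sendGrains i A c j + (if none ∈ A then 1 else 0) = ∑ j, c j := by
  have hcard : A.card = (if none ∈ A then 1 else 0) + ∑ j, if some j ∈ A then 1 else 0 := by
    rw [← Fintype.sum_option (fun x : Option (Fin n) => if x ∈ A then 1 else 0)]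
    simp
  have hpt : ∀ j, sendGrains i A c j + (if j = i then A.card else 0)
      = c j + if some j ∈ A then 1 else 0 := by
    intro j
    unfold sendGrains
    by_cases h : j = i
    · subst h
      simp only [if_true, if_neg hi]
      omega
    · simp [h]
  have := sum_congr (rfl : (univ : Finset (Fin n)) = univ) fun j _ => hpt j
  rw [sum_add_distrib, sum_add_distrib, sum_ite_eq' univ i] at this
  simp only [mem_univ, if_true] at this
  omega

theorem stabilise_eq {I : Fin n → ℕ → Finset (Option (Fin n))}
    (hI : ∀ i k, I i k ⊆ G.neighborFinset (some i)) {c d : Fin n → ℕ}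
    (h : IsStabilisation G I c d) : stabilise G I c = d := by
  have hex : ∃ d, IsStabilisation G I c d := ⟨d, h⟩
  rw [stabilise, dif_pos hex]
  exact IsStabilisation.unique hI hex.choose_spec h

theorem isStable_stabilise {I : Fin n → ℕ → Finset (Option (Fin n))} {c : Fin n → ℕ}
    (h : ∃ d, IsStabilisation G I c d) : IsStable G (stabilise G I c) := by
  rw [stabilise, dif_pos h]
  exact h.choose_spec.choose_spec.2

/-- A property of configurations preserved by the topplings is preserved by stabilisation. -/
theorem stabilise_induction {I : Fin n → ℕ → Finset (Option (Fin n))}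
    {P : (Fin n → ℕ) → Prop}
    (hP : ∀ i k c, G.degree (some i) ≤ c i → P c → P (sendGrains i (I i k) c))
    {c : Fin n → ℕ} (hc : P c) : P (stabilise G I c) := by
  unfold stabilise
  split_ifs with h
  · obtain ⟨u, hu, -⟩ := h.choose_spec
    suffices ∀ s, Relation.ReflTransGen (ToppleStep G I) (c, fun _ => 0) s → P s.1 from this _ hu
    intro s hs
    induction hs with
    | refl => exact hc
    | tail _ hst ih =>
      obtain ⟨i, hi, rfl⟩ := hst
      exact hP _ _ _ hi ih
  -- Without a stabilisation, `stabilise` returns `c` itself, so invariants persist even on paths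
  -- where toppling does not terminate.
  · exact hc

/-- If every vertex is allowed to send a grain to the sink infinitely often, then every
configuration has a stabilisation. -/
theorem exists_isStabilisation_of_frequently {I : Fin n → ℕ → Finset (Option (Fin n))}
    (hI : ∀ i k, I i k ⊆ G.neighborFinset (some i))
    (h : ∀ i, ∃ᶠ k in atTop, none ∈ I i k) (c : Fin n → ℕ) :
    ∃ d, IsStabilisation G I c d := by
  classical
  have hex : ∀ i k, ∃ l, none ∈ I i (k + l) := by
    intro i k
    obtain ⟨b, hb, hb'⟩ := (frequently_atTop.1 (h i)) k
    exact ⟨b - k, by rwa [Nat.add_sub_cancel' hb]⟩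
  -- The waiting time until vertex `i` next sends a grain to the sink. Each toppling either loses a
  -- grain or shortens the total waiting time, so the pair (grains, total waiting time) decreases
  -- lexicographically.
  let gap : Fin n → ℕ → ℕ := fun i k => Nat.find (hex i k)
  suffices ∀ a b (c u : Fin n → ℕ), ∑ i, c i = a → ∑ i, gap i (u i) = b →
      ∃ d w, Relation.ReflTransGen (ToppleStep G I) (c, u) (d, w) ∧ IsStable G d by
    obtain ⟨d, w, hd⟩ := this _ _ c (fun _ => 0) rfl rfl
    exact ⟨d, w, hd⟩
  intro a
  induction a using Nat.strong_induction_on with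
  | _ a iha =>
  intro b
  induction b using Nat.strong_induction_on with
  | _ b ihb =>
  intro c u hca hub
  by_cases hs : IsStable G c
  · exact ⟨c, u, .refl, hs⟩
  unfold IsStable at hs
  push Not at hs
  obtain ⟨i, hi⟩ := hs
  have hsum := sum_sendGrains (some_notMem_of_subset (hI i (u i)))
    ((card_le_degree_of_subset (hI i (u i))).trans hi)
  have hstep : ToppleStep G I (c, u) (sendGrains i (I i (u i)) c, Function.update u i (u i + 1)) :=
    ⟨i, hi, rfl⟩
  by_cases hn : none ∈ I i (u i)
  · rw [if_pos hn] at hsum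
    obtain ⟨d, w, hd, hds⟩ := iha (∑ j, sendGrains i (I i (u i)) c j) (by omega) _ _
      (Function.update u i (u i + 1)) rfl rfl
    exact ⟨d, w, .head hstep hd, hds⟩
  · rw [if_neg hn] at hsum
    have hgap : gap i (u i + 1) < gap i (u i) := by
      have h1 : none ∈ I i (u i + gap i (u i)) := Nat.find_spec (hex i (u i))
      have h0 : gap i (u i) ≠ 0 := fun h0 => hn (by simpa [h0] using h1)
      have h2 : gap i (u i + 1) ≤ gap i (u i) - 1 := by
        refine Nat.find_min' _ ?_
        rwa [show u i + 1 + (gap i (u i) - 1) = u i + gap i (u i) by omega]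
      omega
    obtain ⟨d, w, hd, hds⟩ := ihb (∑ j, gap j (Function.update u i (u i + 1) j)) (by
      rw [← hub]
      refine sum_lt_sum (fun j _ => ?_) ⟨i, mem_univ i, ?_⟩
      · by_cases hj : j = i
        · subst hj
          simpa using hgap.le
        · simp [hj]
      · simpa using hgap) (sendGrains i (I i (u i)) c) (Function.update u i (u i + 1))
      (by omega) rfl
    exact ⟨d, w, .head hstep hd, hds⟩

/-- If every toppling may send a grain to the sink, then the stabilisation uses each vertex at most
as often as there are grains, and depends only on that many toppling instructions. -/
theorem exists_isStabilisation_of_eqOn {A : Fin n → Finset (Option (Fin n))}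
    (hA : ∀ i, A i ⊆ G.neighborFinset (some i)) (hn : ∀ i, none ∈ A i) {K : ℕ}
    {c : Fin n → ℕ} (hc : ∑ i, c i ≤ K) :
    ∃ d, ∀ I : Fin n → ℕ → Finset (Option (Fin n)), (∀ i, ∀ k < K, I i k = A i) →
      IsStabilisation G I c d := by
  -- `N` bounds both the grains left and the topplings still possible; `u i + N ≤ K` keeps every
  -- instruction consulted below index `K`.
  suffices ∀ N (c u : Fin n → ℕ), ∑ i, c i ≤ N → (∀ i, u i + N ≤ K) →
      ∃ d w, IsStable G d ∧ ∀ I : Fin n → ℕ → Finset (Option (Fin n)),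
        (∀ i, ∀ k < K, I i k = A i) →
        Relation.ReflTransGen (ToppleStep G I) (c, u) (d, w) by
    obtain ⟨d, w, hd, h⟩ := this K c (fun _ => 0) hc (by simp)
    exact ⟨d, fun I hI => ⟨w, h I hI, hd⟩⟩
  intro N
  induction N with
  | zero =>
    intro c u hc hu
    refine ⟨c, u, fun i => ?_, fun _ _ => .refl⟩
    rw [Nat.le_zero, sum_eq_zero_iff] at hc
    rw [hc i (mem_univ i), ← G.card_neighborFinset_eq_degree]
    exact card_pos.2 ⟨none, hA i (hn i)⟩
  | succ N ih =>
    intro c u hc hu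
    by_cases hs : IsStable G c
    · exact ⟨c, u, hs, fun _ _ => .refl⟩
    unfold IsStable at hs
    push Not at hs
    obtain ⟨i, hi⟩ := hs
    have hsum := sum_sendGrains (some_notMem_of_subset (hA i))
      ((card_le_degree_of_subset (hA i)).trans hi)
    rw [if_pos (hn i)] at hsum
    obtain ⟨d, w, hd, h⟩ := ih (sendGrains i (A i) c) (Function.update u i (u i + 1)) (by omega)
      (fun j => by
        have := hu j
        by_cases hj : j = i
        · subst hj
          simp only [Function.update_self]
          omega
        · simp only [Function.update_of_ne hj]
          omega)
    refine ⟨d, w, hd, fun I hI => .head ⟨i, hi, ?_⟩ (h I hI)⟩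
    have hui : u i < K := by
      have := hu i
      omega
    simp only [hI i (u i) hui]

/-! ### Deterministic words of grain additions. -/

/-- A vertex at which a grain is added, together with the set of receivers in the topplings of each
vertex. -/
abbrev Letter (n : ℕ) : Type :=
  Fin n × (Fin n → Finset (Option (Fin n)))

variable (G) in
/-- One step of the chain for a grain added at `l.1`, where each toppling of a vertex `i` sends one
grain to each vertex of `l.2 i`. -/
noncomputable def next (l : Letter n) (c : Fin n → ℕ) :
    Fin n → ℕ :=
  stabilise G (fun i _ => l.2 i) (c + Pi.single l.1 1)

variable (G) in
/-- Each toppling sends a grain to the sink. -/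
def IsDissipative (A : Fin n → Finset (Option (Fin n))) : Prop :=
  ∀ i, A i ⊆ G.neighborFinset (some i) ∧ none ∈ A i

theorem IsDissipative.exists_isStabilisation {A : Fin n → Finset (Option (Fin n))}
    (hA : IsDissipative G A) (c : Fin n → ℕ) :
    ∃ d, IsStabilisation G (fun i _ => A i) c d := by
  obtain ⟨d, hd⟩ := exists_isStabilisation_of_eqOn (fun i => (hA i).1) (fun i => (hA i).2)
    (le_refl (∑ i, c i))
  exact ⟨d, hd _ fun _ _ _ => rfl⟩

theorem isStable_next {l : Letter n}
    (hl : IsDissipative G l.2) (c : Fin n → ℕ) : IsStable G (next G l c) :=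
  isStable_stabilise (hl.exists_isStabilisation _)

theorem next_eq_of_isStable {l : Letter n}
    (hl : IsDissipative G l.2) {c : Fin n → ℕ} (hc : IsStable G (c + Pi.single l.1 1)) :
    next G l c = c + Pi.single l.1 1 :=
  stabilise_eq (fun i _ => (hl i).1) ⟨_, .refl, hc⟩

/-- Every toppling prescribed by a dissipative letter loses a grain, so only the first `K`
instructions of each vertex are consulted. This makes one step of the chain depend on finitely many
coins. -/
theorem stabilise_eq_next {l : Letter n}
    (hl : IsDissipative G l.2) {c : Fin n → ℕ} {K : ℕ} (hc : ∑ i, c i < K)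
    {I : Fin n → ℕ → Finset (Option (Fin n))}
    (hI : ∀ i k, I i k ⊆ G.neighborFinset (some i)) (hIl : ∀ i, ∀ k < K, I i k = l.2 i) :
    stabilise G I (c + Pi.single l.1 1) = next G l c := by
  have hsum : ∑ i, (c + Pi.single l.1 1 : Fin n → ℕ) i ≤ K := by
    simp only [Pi.add_apply, sum_add_distrib, sum_pi_single']
    simpa using hc
  obtain ⟨d, hd⟩ := exists_isStabilisation_of_eqOn (fun i => (hl i).1) (fun i => (hl i).2) hsum
  rw [stabilise_eq hI (hd I hIl), next]
  exact (stabilise_eq (fun i _ => (hl i).1) (hd _ fun _ _ _ => rfl)).symm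

/-- The outcome of a word of grain additions. -/
noncomputable def run (G : SimpleGraph (Option (Fin n))) [DecidableRel G.Adj]
    (w : List (Letter n)) (c : Fin n → ℕ) : Fin n → ℕ :=
  w.foldl (fun c l => next G l c) c

theorem run_append (w w' : List (Letter n)) (c : Fin n → ℕ) :
    run G (w ++ w') c = run G w' (run G w c) := List.foldl_append

theorem isStable_run {w : List (Letter n)}
    (hw : ∀ l ∈ w, IsDissipative G l.2) {c : Fin n → ℕ} (hc : IsStable G c) :
    IsStable G (run G w c) := by
  induction w generalizing c with
  | nil => exact hc
  | cons l w ih =>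
    exact ih (fun l' h => hw l' (List.mem_cons_of_mem _ h)) (isStable_next (hw l (by simp)) c)

/-- If a stable configuration `c` can be reached from every stable configuration, then there is one
word that visits `c` from whichever stable configuration it is started. -/
theorem exists_visiting_word {Λ : Set (Letter n)}
    (hΛ : ∀ l ∈ Λ, IsDissipative G l.2) {c : Fin n → ℕ}
    (h : ∀ d, IsStable G d → ∃ w : List (Letter n), (∀ l ∈ w, l ∈ Λ) ∧ run G w d = c) :
    ∃ w : List (Letter n), (∀ l ∈ w, l ∈ Λ) ∧ ∀ d, IsStable G d → ∃ s ≤ w.length, run G (w.take s) d = c := by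
  have hfin : {d : Fin n → ℕ | IsStable G d}.Finite :=
    (Set.finite_Iic (fun i : Fin n => G.degree (some i))).subset fun d hd i => (hd i).le
  suffices ∀ S : Finset (Fin n → ℕ), (∀ d ∈ S, IsStable G d) →
      ∃ w : List (Letter n), (∀ l ∈ w, l ∈ Λ) ∧ ∀ d ∈ S, ∃ s ≤ w.length, run G (w.take s) d = c by
    obtain ⟨w, hw, hv⟩ := this hfin.toFinset (by simp)
    exact ⟨w, hw, fun d hd => hv d (by simpa using hd)⟩
  -- Treat the starting points one at a time: extend the word by one that leads to `c` from wherever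
  -- the new starting point `d` has ended up. Earlier visits lie in the old prefix and are kept.
  intro S
  induction S using Finset.induction_on with
  | empty => exact fun _ => ⟨[], by simp, by simp⟩
  | insert d S _ ih =>
    intro hS
    obtain ⟨w, hw, hv⟩ := ih fun e he => hS e (mem_insert_of_mem he)
    obtain ⟨w', hw', hv'⟩ := h (run G w d)
      (isStable_run (fun l hl => hΛ l (hw l hl)) (hS d (mem_insert_self _ _)))
    refine ⟨w ++ w', fun l hl => (List.mem_append.1 hl).elim (hw l) (hw' l), fun e he => ?_⟩
    rcases mem_insert.1 he with rfl | he
    · exact ⟨(w ++ w').length, le_rfl, by rw [List.take_length, run_append, hv']⟩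
    · obtain ⟨s, hs, hse⟩ := hv e he
      refine ⟨s, hs.trans (by simp), ?_⟩
      rwa [List.take_append_of_le_length hs]

/-- If the letters of the word `w` are used from time `T` on, then the chain follows the word. -/
theorem chain_add_eq_run {v : ℕ → Fin n} {I : ℕ → Fin n → ℕ → Finset (Option (Fin n))}
    (hI : ∀ t i k, I t i k ⊆ G.neighborFinset (some i))
    {w : List (Letter n)}
    (hw : ∀ l ∈ w, IsDissipative G l.2) {K : ℕ} (hK : ∀ d, IsStable G d → ∑ i, d i < K)
    {c : Fin n → ℕ} {T : ℕ} (hT : IsStable G (chain G v I c T))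
    (hmatch : ∀ s (hs : s < w.length), v (T + s) = w[s].1 ∧
      ∀ i, ∀ k < K, I (T + s) i k = w[s].2 i) {s : ℕ} (hs : s ≤ w.length) :
    chain G v I c (T + s) = run G (w.take s) (chain G v I c T) := by
  induction s with
  | zero => rfl
  | succ s ih =>
    have hs' : s < w.length := hs
    obtain ⟨h1, h2⟩ := hmatch s hs'
    have hst : IsStable G (run G (w.take s) (chain G v I c T)) :=
      isStable_run (fun l hl => hw l (List.mem_of_mem_take hl)) hT
    rw [← add_assoc, chain, ih hs'.le, h1, List.take_add_one, List.getElem?_eq_getElem hs',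
      run_append, stabilise_eq_next (hw _ (List.getElem_mem hs')) (hK _ hst) (hI _) h2]
    rfl

end General

end Sandpile

namespace Sandpile

open Finset Filter MeasureTheory ProbabilityTheory

/-! ### Cylinder events, their independence and Borel–Cantelli. -/

section Cylinders

variable {ι α : Type*}

/-- The sequences that agree with `w` on the finite set `F`. -/
def agreeOn (F : Finset ι) (w : ι → α) : Set (ι → α) := Set.pi F fun i => {w i}

theorem mem_agreeOn {F : Finset ι} {w x : ι → α} : x ∈ agreeOn F w ↔ ∀ i ∈ F, x i = w i := by
  simp [agreeOn]

variable [MeasurableSpace α] [MeasurableSingletonClass α]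

theorem measurableSet_agreeOn (F : Finset ι) (w : ι → α) : MeasurableSet (agreeOn F w) :=
  MeasurableSet.pi F.countable_toSet fun _ _ => measurableSet_singleton _

theorem infinitePi_agreeOn (ν : ι → Measure α) [∀ i, IsProbabilityMeasure (ν i)]
    (F : Finset ι) (w : ι → α) :
    Measure.infinitePi ν (agreeOn F w) = ∏ i ∈ F, ν i {w i} :=
  Measure.infinitePi_pi ν fun _ _ => measurableSet_singleton _

theorem pow_le_infinitePi_agreeOn {ν : ι → Measure α} [∀ i, IsProbabilityMeasure (ν i)]
    {q : ENNReal} {w : ι → α} (hq : ∀ i, q ≤ ν i {w i}) (F : Finset ι) :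
    q ^ F.card ≤ Measure.infinitePi ν (agreeOn F w) := by
  rw [infinitePi_agreeOn, ← prod_const]
  exact prod_le_prod' fun i _ => hq i

theorem iIndepSet_agreeOn (ν : ι → Measure α) [∀ i, IsProbabilityMeasure (ν i)]
    {F : ℕ → Finset ι} (hF : Pairwise fun a b => Disjoint (F a) (F b)) (w : ι → α) :
    iIndepSet (fun m => agreeOn (F m) w) (Measure.infinitePi ν) := by
  classical
  rw [iIndepSet_iff_meas_biInter fun m => measurableSet_agreeOn _ _]
  intro S
  have : ⋂ m ∈ S, agreeOn (F m) w = agreeOn (S.biUnion F) w := by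
    ext x
    simp only [Set.mem_iInter, mem_agreeOn, mem_biUnion]
    grind
  rw [this, infinitePi_agreeOn, prod_biUnion fun a _ b _ hab => hF hab]
  simp only [infinitePi_agreeOn]

theorem iIndepSet_prod {Ω Ω' : Type*} [MeasurableSpace Ω] [MeasurableSpace Ω'] {P : Measure Ω}
    {Q : Measure Ω'} [IsProbabilityMeasure P] [IsProbabilityMeasure Q] {s : ℕ → Set Ω}
    {t : ℕ → Set Ω'} (hsm : ∀ m, MeasurableSet (s m)) (htm : ∀ m, MeasurableSet (t m))
    (hs : iIndepSet s P) (ht : iIndepSet t Q) :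
    iIndepSet (fun m => s m ×ˢ t m) (P.prod Q) := by
  rw [iIndepSet_iff_meas_biInter hsm] at hs
  rw [iIndepSet_iff_meas_biInter htm] at ht
  rw [iIndepSet_iff_meas_biInter fun m => (hsm m).prod (htm m)]
  intro S
  have : ⋂ m ∈ S, s m ×ˢ t m = (⋂ m ∈ S, s m) ×ˢ ⋂ m ∈ S, t m := by
    ext x
    simp only [Set.mem_iInter, Set.mem_prod]
    grind
  rw [this, Measure.prod_prod, hs, ht, ← prod_mul_distrib]
  simp only [Measure.prod_prod]

/-- Independent events of probability bounded below almost surely occur infinitely often. -/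
theorem ae_frequently_of_iIndepSet {Ω : Type*} [MeasurableSpace Ω] {P : Measure Ω}
    [IsProbabilityMeasure P] {s : ℕ → Set Ω} (hsm : ∀ m, MeasurableSet (s m))
    (hs : iIndepSet s P) {ε : ENNReal} (hε : ε ≠ 0) (h : ∀ m, ε ≤ P (s m)) :
    ∀ᵐ ω ∂P, ∃ᶠ m in atTop, ω ∈ s m := by
  have htop : ∑' m, P (s m) = ⊤ :=
    top_unique ((ENNReal.tsum_const_eq_top_of_ne_zero hε).symm.trans_le
      (ENNReal.tsum_le_tsum h))
  have := measure_limsup_eq_one hsm hs htop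
  rw [← prob_compl_eq_zero_iff (MeasurableSet.measurableSet_limsup hsm)] at this
  filter_upwards [measure_eq_zero_iff_ae_notMem.1 this] with ω hω
  rw [Set.notMem_compl_iff, mem_limsup_iff_frequently_mem] at hω
  exact hω

theorem ae_frequently_agreeOn {ν : ι → Measure α} [∀ i, IsProbabilityMeasure (ν i)]
    {F : ℕ → Finset ι} (hF : Pairwise fun a b => Disjoint (F a) (F b)) {N : ℕ}
    (hN : ∀ m, (F m).card = N) {w : ι → α} {q : ENNReal} (hq0 : q ≠ 0)
    (hq : ∀ i, q ≤ ν i {w i}) :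
    ∀ᵐ x ∂Measure.infinitePi ν, ∃ᶠ m in atTop, x ∈ agreeOn (F m) w :=
  ae_frequently_of_iIndepSet (fun _ => measurableSet_agreeOn _ _) (iIndepSet_agreeOn ν hF w)
    (pow_ne_zero N hq0) fun m => (hN m) ▸ pow_le_infinitePi_agreeOn hq (F m)

theorem ae_frequently_agreeOn_prod {κ β : Type*} [MeasurableSpace β] [MeasurableSingletonClass β]
    {ν : ι → Measure α} [∀ i, IsProbabilityMeasure (ν i)]
    {ρ : κ → Measure β} [∀ i, IsProbabilityMeasure (ρ i)]
    {F : ℕ → Finset ι} (hF : Pairwise fun a b => Disjoint (F a) (F b)) {N : ℕ}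
    (hN : ∀ m, (F m).card = N) {w : ι → α} {q : ENNReal} (hq0 : q ≠ 0)
    (hq : ∀ i, q ≤ ν i {w i})
    {F' : ℕ → Finset κ} (hF' : Pairwise fun a b => Disjoint (F' a) (F' b)) {N' : ℕ}
    (hN' : ∀ m, (F' m).card = N') {w' : κ → β} {q' : ENNReal} (hq0' : q' ≠ 0)
    (hq' : ∀ i, q' ≤ ρ i {w' i}) :
    ∀ᵐ x ∂(Measure.infinitePi ν).prod (Measure.infinitePi ρ),
      ∃ᶠ m in atTop, x ∈ agreeOn (F m) w ×ˢ agreeOn (F' m) w' := by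
  refine ae_frequently_of_iIndepSet
    (fun m => (measurableSet_agreeOn _ _).prod (measurableSet_agreeOn _ _))
    (iIndepSet_prod (fun _ => measurableSet_agreeOn _ _) (fun _ => measurableSet_agreeOn _ _)
      (iIndepSet_agreeOn ν hF w) (iIndepSet_agreeOn ρ hF' w'))
    (mul_ne_zero (pow_ne_zero N hq0) (pow_ne_zero N' hq0')) fun m => ?_
  rw [Measure.prod_prod]
  exact mul_le_mul' ((hN m) ▸ pow_le_infinitePi_agreeOn hq (F m))
    ((hN' m) ▸ pow_le_infinitePi_agreeOn hq' (F' m))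

end Cylinders

end Sandpile

namespace Sandpile

open Finset

section Wheel

/-! ### The wheel graph, with $n=m+3$ and cyclic arithmetic in `Fin (m + 3)`. -/

variable {m : ℕ}

open scoped Fin.NatCast Fin.CommRing

theorem fin_add_one_ne (i : Fin (m + 3)) : i + 1 ≠ i := by simp

theorem fin_sub_one_ne (i : Fin (m + 3)) : i - 1 ≠ i := by simp

/-- Since $n\ge 3$, $2\ne 0$ modulo $n$; the two cycle neighbours are distinct and all degrees are
3. -/
theorem fin_sub_one_ne_add_one (i : Fin (m + 3)) : i - 1 ≠ i + 1 := by
  intro h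
  have h2 : (1 + 1 : Fin (m + 3)) = 0 := by
    rw [sub_eq_iff_eq_add, add_assoc] at h
    simpa using h
  have := congrArg Fin.val h2
  rw [Fin.val_add, Fin.val_one, Nat.mod_eq_of_lt (by omega)] at this
  simp at this

theorem neighborFinset_wheelGraph (i : Fin (m + 3)) :
    (wheelGraph (m + 3)).neighborFinset (some i) = {none, some (i - 1), some (i + 1)} := by
  ext (_ | j)
  · simp only [SimpleGraph.mem_neighborFinset, mem_insert, true_or, iff_true]
    trivial
  · simp only [SimpleGraph.mem_neighborFinset, mem_insert, reduceCtorEq, false_or,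
      Option.some_inj, mem_singleton]
    change (SimpleGraph.cycleGraph (m + 3)).Adj i j ↔ _
    rw [SimpleGraph.cycleGraph_adj]
    grind

theorem degree_wheelGraph (i : Fin (m + 3)) : (wheelGraph (m + 3)).degree (some i) = 3 := by
  rw [← SimpleGraph.card_neighborFinset_eq_degree, neighborFinset_wheelGraph,
    card_insert_of_notMem (by simp), card_pair]
  simpa using fin_sub_one_ne_add_one i

theorem isStable_wheelGraph {c : Fin (m + 3) → ℕ} :
    IsStable (wheelGraph (m + 3)) c ↔ ∀ i, c i < 3 := by
  simp only [IsStable, degree_wheelGraph]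

variable (m) in
/-- The instructions that send a grain to every neighbour. -/
def fullInstr (i : Fin (m + 3)) : Finset (Option (Fin (m + 3))) :=
  (wheelGraph (m + 3)).neighborFinset (some i)

theorem isDissipative_fullInstr : IsDissipative (wheelGraph (m + 3)) (fullInstr m) := fun i =>
  ⟨subset_rfl, by rw [fullInstr, neighborFinset_wheelGraph]; simp⟩

theorem sendGrains_fullInstr (i : Fin (m + 3)) (c : Fin (m + 3) → ℕ) (j : Fin (m + 3)) :
    sendGrains i (fullInstr m i) c j =
      if j = i then c j - 3 else c j + (if j = i - 1 ∨ j = i + 1 then 1 else 0) := by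
  unfold sendGrains fullInstr
  rw [SimpleGraph.card_neighborFinset_eq_degree, degree_wheelGraph, neighborFinset_wheelGraph]
  simp

/-! ### The orientation invariant, valid for both models. -/

/-- The edges of the cycle can be oriented so that no vertex has more incoming edges than grains.
The edge from `i` to `i + 1` points to `i + 1` if `o i` is true. -/
def Oriented (c : Fin (m + 3) → ℕ) : Prop :=
  ∃ o : Fin (m + 3) → Bool, ∀ i,
    (if o i = true then 0 else 1) + (if o (i - 1) = true then 1 else 0) ≤ c i

theorem oriented_two : Oriented (fun _ : Fin (m + 3) => 2) :=
  ⟨fun _ => true, fun _ => by simp⟩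

theorem Oriented.mono {c d : Fin (m + 3) → ℕ} (hc : Oriented c) (h : c ≤ d) : Oriented d := by
  obtain ⟨o, ho⟩ := hc
  exact ⟨o, fun i => (ho i).trans (h i)⟩

theorem Oriented.sendGrains {c : Fin (m + 3) → ℕ} (hc : Oriented c) {i : Fin (m + 3)}
    {A : Finset (Option (Fin (m + 3)))}
    (hA : A ⊆ (wheelGraph (m + 3)).neighborFinset (some i)) (hi : 3 ≤ c i) :
    Oriented (sendGrains i A c) := by
  obtain ⟨o, ho⟩ := hc
  have h1 := fin_add_one_ne i
  have h2 := fin_sub_one_ne i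
  have h3 := fin_sub_one_ne_add_one i
  have hcard : A.card ≤ 1 + (if some (i - 1) ∈ A then 1 else 0)
      + (if some (i + 1) ∈ A then 1 else 0) := by
    rw [neighborFinset_wheelGraph] at hA
    have hsub : A ⊆ {none} ∪ ((if some (i - 1) ∈ A then {some (i - 1)} else ∅) ∪
        (if some (i + 1) ∈ A then {some (i + 1)} else ∅)) := by
      intro x hx
      have := hA hx
      simp only [mem_insert, mem_singleton] at this
      rcases this with rfl | rfl | rfl <;> simp [hx]
    refine (card_le_card hsub).trans ((card_union_le _ _).trans ?_)
    rw [card_singleton, add_assoc]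
    refine Nat.add_le_add_left ((card_union_le _ _).trans ?_) 1
    split_ifs <;> simp
  -- Each edge along which `i` sends a grain now points away from `i`. A receiver gains a grain and
  -- at most one incoming edge; `i` keeps at least 2 grains minus one per cycle neighbour served,
  -- and has at most that many incoming edges.
  refine ⟨fun j => if j = i then o i || decide (some (i + 1) ∈ A) else
    if j = i - 1 then o j && !decide (some (i - 1) ∈ A) else o j, fun j => ?_⟩
  have hj := ho j
  unfold Sandpile.sendGrains
  by_cases hji : j = i
  · subst hji
    simp only [if_true, if_neg h2]
    by_cases ha : some (j + 1) ∈ A <;> by_cases hb : some (j - 1) ∈ A <;>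
      simp only [ha, hb, if_true, if_false] at hcard ⊢ <;>
      cases o j <;> cases o (j - 1) <;> simp <;> omega
  · by_cases hj1 : j = i + 1
    · subst hj1
      simp only [add_sub_cancel_right, if_neg h1, if_neg h3.symm, if_true] at hj ⊢
      by_cases ha : some (i + 1) ∈ A <;> simp only [ha, if_true, if_false] <;>
        cases ho1 : o i <;> cases ho2 : o (i + 1) <;> simp [ho1, ho2] at hj ⊢ <;> omega
    · have hj2 : j - 1 ≠ i := fun h => hj1 (by rw [← h]; simp)
      have hj3 : j - 1 ≠ i - 1 := fun h => hji (by simpa using h)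
      by_cases hjm : j = i - 1
      · subst hjm
        simp only [if_neg h2, if_neg hj2, if_neg hj3, if_true]
        by_cases ha : some (i - 1) ∈ A <;> simp only [ha, if_true, if_false] <;>
          cases ho1 : o (i - 1) <;> cases ho2 : o (i - 1 - 1) <;> simp [ho1, ho2] at hj ⊢ <;>
          omega
      · simp only [if_neg hji, if_neg hj2, if_neg hj3, if_neg hjm]
        omega

/-! ### The burning invariant, valid for complete topplings. -/

/-- Every nonempty set of vertices contains a vertex with at least as many grains as neighbours in
the set. -/
def Burnable (c : Fin (m + 3) → ℕ) : Prop :=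
  ∀ S : Finset (Fin (m + 3)), S.Nonempty →
    ∃ i ∈ S, (if i - 1 ∈ S then 1 else 0) + (if i + 1 ∈ S then 1 else 0) ≤ c i

theorem burnable_two : Burnable (fun _ : Fin (m + 3) => 2) := by
  rintro S ⟨i, hi⟩
  exact ⟨i, hi, by split_ifs <;> simp⟩

theorem Burnable.mono {c d : Fin (m + 3) → ℕ} (hc : Burnable c) (h : c ≤ d) : Burnable d := by
  intro S hS
  obtain ⟨i, hi, hci⟩ := hc S hS
  exact ⟨i, hi, hci.trans (h i)⟩

/-- Only `v` loses grains. If `v ∈ S`, apply the hypothesis to `S.erase v`: putting `v` back costs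
its neighbours one each, which is the grain they have just received. If `S = {v}`, no grains are
needed. -/
theorem Burnable.sendGrains {c : Fin (m + 3) → ℕ} (hc : Burnable c) (v : Fin (m + 3)) :
    Burnable (sendGrains v (fullInstr m v) c) := by
  intro S hS
  by_cases hv : v ∈ S
  · rcases (S.erase v).eq_empty_or_nonempty with he | he
    · refine ⟨v, hv, ?_⟩
      have h1 : v - 1 ∉ S := fun h => by
        have := mem_erase.2 ⟨fin_sub_one_ne v, h⟩
        simp [he] at this
      have h2 : v + 1 ∉ S := fun h => by
        have := mem_erase.2 ⟨fin_add_one_ne v, h⟩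
        simp [he] at this
      simp [h1, h2]
    · obtain ⟨i, hi, hci⟩ := hc _ he
      obtain ⟨hiv, hiS⟩ := mem_erase.1 hi
      refine ⟨i, hiS, ?_⟩
      rw [sendGrains_fullInstr, if_neg hiv]
      simp only [mem_erase] at hci
      by_cases h1 : i = v - 1
      · have h1' : i + 1 = v := by rw [h1]; simp
        have h2 : i - 1 ≠ v := fun h => fin_sub_one_ne_add_one i (h.trans h1'.symm)
        simp only [h2, h1', ne_eq, not_true_eq_false, not_false_eq_true, true_and, false_and,
          if_false, hv, if_true] at hci ⊢
        simp only [h1, true_or, if_true] at hci ⊢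
        omega
      · have h1' : i + 1 ≠ v := fun h => h1 (by rw [← h]; simp)
        by_cases h2 : i = v + 1
        · have h2' : i - 1 = v := by rw [h2]; simp
          simp only [h2', h1', ne_eq, not_true_eq_false, not_false_eq_true, true_and, false_and,
            if_false, hv, if_true] at hci ⊢
          simp only [h2, or_true, if_true] at hci ⊢
          omega
        · have h2' : i - 1 ≠ v := fun h => h2 (by rw [← h]; simp)
          simp only [h1', h2', ne_eq, not_false_eq_true, true_and] at hci
          simp only [h1, h2, or_self, if_false]
          omega
  · obtain ⟨i, hi, hci⟩ := hc S hS
    refine ⟨i, hi, hci.trans ?_⟩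
    rw [sendGrains_fullInstr, if_neg (fun h : i = v => hv (h ▸ hi))]
    omega

theorem Burnable.exists_eq_two {c : Fin (m + 3) → ℕ} (hc : Burnable c)
    (hs : ∀ i, c i < 3) : ∃ i, c i = 2 := by
  obtain ⟨i, -, hi⟩ := hc univ univ_nonempty
  have := hs i
  simp only [mem_univ, if_true] at hi
  exact ⟨i, by omega⟩

/-- Arcs become walks of `t` clockwise steps from `i`, which permits induction along them. The value
`τ = n` covers the convention for `i = j`. -/
theorem mem_openArc_iff {n : ℕ} {i j k : Fin n} {τ : ℕ} (h1 : 1 ≤ τ) (hn : τ ≤ n)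
    (hj : j.val = (i.val + τ) % n) :
    k ∈ openArc i j ↔ ∃ t, 0 < t ∧ t < τ ∧ k.val = (i.val + t) % n := by
  have hmod : ∀ a, a < 2 * n → a % n = if a < n then a else a - n := by
    intro a ha
    split_ifs with h
    · exact Nat.mod_eq_of_lt h
    · rw [Nat.mod_eq_sub_mod (not_lt.1 h), Nat.mod_eq_of_lt (by omega)]
  have hi := i.isLt
  have hk := k.isLt
  rw [hmod _ (by omega)] at hj
  have key : k ∈ openArc i j ↔ if i.val = j.val then k.val ≠ i.val else
      if i.val < j.val then i.val < k.val ∧ k.val < j.val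
      else i.val < k.val ∨ k.val < j.val := by
    unfold openArc
    simp only [← Fin.ext_iff, ← Fin.lt_def]
    split_ifs <;> simp [Fin.ext_iff]
  rw [key]
  constructor
  · intro h
    refine ⟨if i.val < k.val then k.val - i.val else k.val + n - i.val, ?_, ?_, ?_⟩
    · split_ifs <;> omega
    · split_ifs at * <;> omega
    · rw [hmod _ (by split_ifs <;> omega)]
      split_ifs at * <;> omega
  · rintro ⟨t, ht0, htτ, hkt⟩
    rw [hmod _ (by omega)] at hkt
    split_ifs at * <;> omega

theorem val_add_natCast (i : Fin (m + 3)) (t : ℕ) :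
    (i + (t : Fin (m + 3))).val = (i.val + t) % (m + 3) := by
  rw [Fin.val_add, Fin.val_natCast, Nat.add_mod_mod]

theorem mem_openArc_add_natCast {i k : Fin (m + 3)} {τ : ℕ} (h1 : 1 ≤ τ) (hn : τ ≤ m + 3) :
    k ∈ openArc i (i + (τ : Fin (m + 3))) ↔
      ∃ t : ℕ, 0 < t ∧ t < τ ∧ k = i + (t : Fin (m + 3)) := by
  rw [mem_openArc_iff h1 hn (val_add_natCast i τ)]
  simp only [Fin.ext_iff, val_add_natCast]

theorem exists_eq_add_natCast (i j : Fin (m + 3)) :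
    ∃ τ : ℕ, 1 ≤ τ ∧ τ ≤ m + 3 ∧ j = i + (τ : Fin (m + 3)) := by
  have hi := i.isLt
  have hj := j.isLt
  refine ⟨if i.val < j.val then j.val - i.val else j.val + (m + 3) - i.val, ?_, ?_, ?_⟩
  · split_ifs <;> omega
  · split_ifs <;> omega
  · rw [Fin.ext_iff, val_add_natCast]
    split_ifs
    · rw [Nat.mod_eq_of_lt (by omega)]
      omega
    · rw [show i.val + (j.val + (m + 3) - i.val) = j.val + (m + 3) by omega, Nat.add_mod_right,
        Nat.mod_eq_of_lt hj]

/-! ### Separated zeros, compared with the two invariants. -/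

/-- Between any two empty vertices there is a vertex with two grains. -/
def ZerosSeparated (c : Fin (m + 3) → ℕ) : Prop :=
  ∀ i j, c i = 0 → c j = 0 → ∃ k ∈ openArc i j, c k = 2

theorem Oriented.zerosSeparated {c : Fin (m + 3) → ℕ} (hc : Oriented c) (hs : ∀ i, c i < 3) :
    ZerosSeparated c := by
  obtain ⟨o, ho⟩ := hc
  intro i j hi hj
  by_contra! hne
  obtain ⟨τ, h1, hn, rfl⟩ := exists_eq_add_natCast i j
  have hcast : ∀ t : ℕ, i + ((t + 1 : ℕ) : Fin (m + 3)) - 1 = i + (t : Fin (m + 3)) := by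
    intro t
    push_cast
    abel
  have hall : ∀ t : ℕ, t < τ → o (i + (t : Fin (m + 3))) = true := by
    intro t
    induction t with
    | zero =>
      intro _
      have := ho i
      by_contra h
      simp only [Nat.cast_zero, add_zero] at h
      simp [h, hi] at this
    | succ t ih =>
      intro ht
      have h2 := hne _ ((mem_openArc_add_natCast h1 hn).2 ⟨t + 1, by omega, ht, rfl⟩)
      have h3 := hs (i + ((t + 1 : ℕ) : Fin (m + 3)))
      have h4 := ho (i + ((t + 1 : ℕ) : Fin (m + 3)))
      rw [hcast, ih (by omega)] at h4
      by_contra h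
      simp only [h, if_true] at h4
      simp at h4
      push_cast at h2 h3
      omega
  have h5 := ho (i + (τ : Fin (m + 3)))
  obtain ⟨t, rfl⟩ : ∃ t, τ = t + 1 := ⟨τ - 1, by omega⟩
  rw [hcast, hall t (by omega), hj] at h5
  simp at h5

/-- In a set `S` violating burnability every vertex has fewer grains than neighbours in `S`, so none
has 2, and `S` is not the whole cycle. A maximal arc of `S` then has empty ends and no 2 between
them. -/
theorem ZerosSeparated.burnable {c : Fin (m + 3) → ℕ} (hc : ZerosSeparated c)
    (h2 : ∃ i, c i = 2) : Burnable c := by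
  intro S hS
  by_contra! hne
  by_cases huniv : ∀ i, i ∈ S
  · obtain ⟨i, hi⟩ := h2
    have := hne i (huniv i)
    simp [huniv, hi] at this
  obtain ⟨i, hiS, hi⟩ : ∃ i ∈ S, i - 1 ∉ S := by
    by_contra! hcl
    obtain ⟨i, hi⟩ := hS
    refine huniv fun j => ?_
    obtain ⟨τ, -, -, rfl⟩ := exists_eq_add_natCast j i
    have : ∀ t : ℕ, j + (t : Fin (m + 3)) ∈ S → j ∈ S := by
      intro t
      induction t with
      | zero => simp
      | succ t ih =>
        intro h
        have := hcl _ h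
        rw [show j + ((t + 1 : ℕ) : Fin (m + 3)) - 1 = j + (t : Fin (m + 3)) by
          push_cast; abel] at this
        exact ih this
    exact this τ hi
  -- Walking clockwise from `i` must leave `S`, at `i - 1` at the latest; the least such `t` makes
  -- `i + t` the last vertex of the arc.
  have hex : ∃ t : ℕ, i + ((t + 1 : ℕ) : Fin (m + 3)) ∉ S := by
    obtain ⟨τ, h1, -, h⟩ := exists_eq_add_natCast i (i - 1)
    exact ⟨τ - 1, by rwa [Nat.sub_add_cancel h1, ← h]⟩
  classical
  set τ := Nat.find hex with hτ
  have hend : i + ((τ + 1 : ℕ) : Fin (m + 3)) ∉ S := Nat.find_spec hex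
  have hmem : ∀ t : ℕ, t ≤ τ → i + (t : Fin (m + 3)) ∈ S := by
    rintro (_ | t) ht
    · simpa using hiS
    · by_contra h
      exact absurd (Nat.find_min' hex h) (by omega)
  have hci := hne i hiS
  have hcj := hne _ (hmem τ le_rfl)
  rw [show i + ((τ + 1 : ℕ) : Fin (m + 3)) = i + (τ : Fin (m + 3)) + 1 by
    push_cast; abel] at hend
  rw [if_neg hi] at hci
  rw [if_neg hend] at hcj
  have hτ1 : 1 ≤ τ := by
    by_contra h0
    obtain h0 : τ = 0 := by omega
    rw [h0] at hend
    simp only [Nat.cast_zero, add_zero] at hend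
    simp [hend] at hci
  have hτn : τ ≤ m + 3 := by
    by_contra hlt
    obtain ⟨σ, h1, hn, h⟩ := exists_eq_add_natCast i (i - 1)
    exact hi (h ▸ hmem σ (by omega))
  obtain ⟨k, hk, hk2⟩ := hc i (i + (τ : Fin (m + 3)))
    (by split_ifs at hci <;> omega) (by split_ifs at hcj <;> omega)
  obtain ⟨t, -, ht, rfl⟩ := (mem_openArc_add_natCast hτ1 hτn).1 hk
  have := hne _ (hmem t ht.le)
  split_ifs at this <;> omega

/-! ### Abelian topplings and reachability from the maximal configuration. -/

/-- One legal Abelian toppling. -/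
def Fires (c d : Fin (m + 3) → ℕ) : Prop :=
  ∃ i, 3 ≤ c i ∧ d = sendGrains i (fullInstr m i) c

theorem Fires.add_right {c d : Fin (m + 3) → ℕ} (h : Fires c d) (e : Fin (m + 3) → ℕ) :
    Fires (c + e) (d + e) := by
  obtain ⟨i, hi, rfl⟩ := h
  refine ⟨i, hi.trans (Nat.le_add_right _ _), ?_⟩
  funext j
  simp only [Pi.add_apply, sendGrains_fullInstr]
  by_cases hj : j = i
  · subst hj
    simp only [if_true]
    omega
  · simp only [if_neg hj]
    omega

theorem Fires.reflTransGen_add_right {c d : Fin (m + 3) → ℕ}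
    (h : Relation.ReflTransGen Fires c d) (e : Fin (m + 3) → ℕ) :
    Relation.ReflTransGen Fires (c + e) (d + e) := by
  induction h with
  | refl => exact .refl
  | tail _ h ih => exact ih.tail (h.add_right e)

theorem isStabilisation_of_fires {c d : Fin (m + 3) → ℕ}
    (h : Relation.ReflTransGen Fires c d) (hd : IsStable (wheelGraph (m + 3)) d) :
    IsStabilisation (wheelGraph (m + 3)) (fun i _ => fullInstr m i) c d := by
  suffices ∃ u, Relation.ReflTransGen (ToppleStep (wheelGraph (m + 3)) fun i _ => fullInstr m i)
      (c, fun _ => 0) (d, u) by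
    obtain ⟨u, hu⟩ := this
    exact ⟨u, hu, hd⟩
  clear hd
  induction h with
  | refl => exact ⟨_, .refl⟩
  | tail _ h ih =>
    obtain ⟨u, hu⟩ := ih
    obtain ⟨i, hi, rfl⟩ := h
    exact ⟨_, hu.tail ⟨i, (degree_wheelGraph i).trans_le hi, rfl⟩⟩

theorem fires_of_isStabilisation {c d : Fin (m + 3) → ℕ}
    (h : IsStabilisation (wheelGraph (m + 3)) (fun i _ => fullInstr m i) c d) :
    Relation.ReflTransGen Fires c d := by
  obtain ⟨u, hu, -⟩ := h
  suffices ∀ s t, Relation.ReflTransGen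
      (ToppleStep (wheelGraph (m + 3)) fun i _ => fullInstr m i) s t →
      Relation.ReflTransGen Fires s.1 t.1 from this _ _ hu
  intro s t hst
  induction hst with
  | refl => exact .refl
  | tail _ h ih =>
    obtain ⟨i, hi, rfl⟩ := h
    exact ih.tail ⟨i, (degree_wheelGraph i).symm.trans_le hi, rfl⟩

/-- The burning algorithm: after each vertex receives one grain from the sink, every vertex can
fire exactly once. -/
theorem Burnable.fires {c : Fin (m + 3) → ℕ} (hc : Burnable c) :
    Relation.ReflTransGen Fires (c + fun _ => 1) c := by
  -- `S` is the set of vertices that have already fired, and the equation records the grains at that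
  -- stage. Once `S` is everything, each vertex has lost 3 and gained 1 + 2.
  suffices ∀ (k : ℕ) (S : Finset (Fin (m + 3))) (d : Fin (m + 3) → ℕ), Sᶜ.card = k →
      (∀ j, d j + (if j ∈ S then 3 else 0) =
        c j + 1 + (if j - 1 ∈ S then 1 else 0) + (if j + 1 ∈ S then 1 else 0)) →
      Relation.ReflTransGen Fires d c from
    this _ ∅ _ rfl (by simp)
  intro k
  induction k with
  | zero =>
    intro S d hS hd
    rw [card_eq_zero, compl_eq_empty_iff] at hS
    subst hS
    obtain rfl : d = c := by
      funext j
      have := hd j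
      simp only [mem_univ, if_true] at this
      omega
    exact .refl
  | succ k ih =>
    intro S d hS hd
    -- This `i` has a grain for each unfired neighbour, one from each fired neighbour and one from
    -- the sink: at least 3 in all.
    obtain ⟨i, hi, hci⟩ := hc Sᶜ (card_pos.1 (by omega))
    rw [mem_compl] at hi
    refine .head ⟨i, ?_, rfl⟩ (ih (insert i S) _ ?_ fun j => ?_)
    · have := hd i
      simp only [mem_compl] at hci
      rw [if_neg hi] at this
      split_ifs at * <;> omega
    · rw [compl_insert, card_erase_of_mem (mem_compl.2 hi), hS]
      rfl
    · have := hd j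
      rw [sendGrains_fullInstr]
      by_cases hji : j = i
      · subst hji
        rw [if_neg hi] at this
        simp only [mem_compl] at hci
        simp only [mem_insert, fin_sub_one_ne, fin_add_one_ne, true_or, if_true, false_or]
        split_ifs at * <;> omega
      · have e1 : j - 1 = i ↔ j = i + 1 := sub_eq_iff_eq_add
        have e2 : j + 1 = i ↔ j = i - 1 := eq_sub_iff_add_eq.symm
        have h3 := fin_sub_one_ne_add_one i
        simp only [mem_insert, hji, false_or, if_false, e1, e2]
        by_cases a1 : j = i + 1
        · have a2 : j ≠ i - 1 := fun h => h3 (h.symm.trans a1)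
          have a3 : j - 1 ∉ S := by rwa [e1.2 a1]
          rw [if_neg a3] at this
          simp only [eq_true a1, eq_false a2, true_or, or_true, false_or, if_true]
          omega
        · by_cases a2 : j = i - 1
          · have a3 : j + 1 ∉ S := by rwa [e2.2 a2]
            rw [if_neg a3] at this
            simp only [eq_false a1, eq_true a2, true_or, false_or, if_true]
            omega
          · simp only [a1, a2, false_or, or_self, if_false]
            omega

variable (m) in
/-- The grain additions of the Abelian model. -/
def asmLetters : Set (Letter (m + 3)) := {l | l.2 = fullInstr m}

theorem isDissipative_of_mem_asmLetters {l : Letter (m + 3)} (hl : l ∈ asmLetters m) :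
    IsDissipative (wheelGraph (m + 3)) l.2 :=
  hl ▸ isDissipative_fullInstr

/-- Adding grains leads from every stable configuration to the maximal one. -/
theorem exists_run_eq_two {d : Fin (m + 3) → ℕ} (hd : IsStable (wheelGraph (m + 3)) d) :
    ∃ w : List (Letter (m + 3)), (∀ l ∈ w, l ∈ asmLetters m) ∧
      run (wheelGraph (m + 3)) w d = fun _ => 2 := by
  generalize hk : ∑ i, (2 - d i) = k
  induction k generalizing d with
  | zero =>
    refine ⟨[], by simp, funext fun i => ?_⟩
    have h1 := sum_eq_zero_iff.1 hk i (mem_univ i)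
    have h2 := isStable_wheelGraph.1 hd i
    change d i = 2
    omega
  | succ k ih =>
    obtain ⟨v, -, hv⟩ : ∃ v ∈ univ, 2 - d v ≠ 0 :=
      exists_ne_zero_of_sum_ne_zero (by omega)
    have hd' : IsStable (wheelGraph (m + 3)) (d + Pi.single v 1) := by
      rw [isStable_wheelGraph] at hd ⊢
      intro j
      have := hd j
      by_cases hj : j = v
      · subst hj
        simp only [Pi.add_apply, Pi.single_eq_same]
        omega
      · simpa [hj] using this
    obtain ⟨w, hw, hrun⟩ := ih hd' (by
      rw [← add_sum_erase univ _ (mem_univ v)] at hk ⊢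
      rw [sum_congr rfl (g := fun j => 2 - d j) fun j hj => by
        simp [(mem_erase.1 hj).1]]
      simp only [Pi.add_apply, Pi.single_eq_same]
      omega)
    refine ⟨(v, fullInstr m) :: w, fun l hl => ?_, ?_⟩
    · rcases List.mem_cons.1 hl with rfl | hl
      · rfl
      · exact hw l hl
    · rw [← hrun]
      change run _ w (next _ _ d) = _
      rw [next_eq_of_isStable isDissipative_fullInstr hd']

/-- Adding grains one by one and stabilising each time amounts to adding all of them and then
toppling. -/
theorem exists_run_fires (c e : Fin (m + 3) → ℕ) :
    ∃ w : List (Letter (m + 3)), (∀ l ∈ w, l ∈ asmLetters m) ∧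
      Relation.ReflTransGen Fires (c + e) (run (wheelGraph (m + 3)) w c) := by
  generalize hk : ∑ i, e i = k
  induction k generalizing e with
  | zero =>
    obtain rfl : e = 0 := funext fun i => sum_eq_zero_iff.1 hk i (mem_univ i)
    exact ⟨[], by simp, .refl⟩
  | succ k ih =>
    obtain ⟨v, -, hv⟩ : ∃ v ∈ univ, e v ≠ 0 := exists_ne_zero_of_sum_ne_zero (by omega)
    obtain ⟨e, rfl⟩ : ∃ e', e = e' + Pi.single v 1 := by
      refine ⟨e - Pi.single v 1, (tsub_add_cancel_of_le ?_).symm⟩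
      intro j
      by_cases hj : j = v
      · subst hj
        simpa using Nat.one_le_iff_ne_zero.2 hv
      · simp [hj]
    obtain ⟨w, hw, hrun⟩ := ih e (by
      simp only [Pi.add_apply, sum_add_distrib, sum_pi_single', mem_univ, if_true] at hk
      omega)
    obtain ⟨f, hf⟩ := (isDissipative_fullInstr (m := m)).exists_isStabilisation
      (run (wheelGraph (m + 3)) w c + Pi.single v 1)
    refine ⟨w ++ [(v, fullInstr m)], fun l hl => ?_, ?_⟩
    · rcases List.mem_append.1 hl with hl | hl
      · exact hw l hl
      · rw [List.mem_singleton.1 hl]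
        rfl
    · have : run (wheelGraph (m + 3)) (w ++ [(v, fullInstr m)]) c = f := by
        rw [run_append]
        exact stabilise_eq (fun i _ => (isDissipative_fullInstr i).1) hf
      rw [this, ← add_assoc]
      exact (Fires.reflTransGen_add_right hrun _).trans (fires_of_isStabilisation hf)

/-- Adding `c` to the maximal configuration gives $c+\mathbf 1+\mathbf 1$, and burning twice topples
this to `c`; uniqueness of stabilisation identifies the outcome of the word with `c`. -/
theorem Burnable.exists_run_two_eq {c : Fin (m + 3) → ℕ} (hc : Burnable c)
    (hs : IsStable (wheelGraph (m + 3)) c) :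
    ∃ w : List (Letter (m + 3)), (∀ l ∈ w, l ∈ asmLetters m) ∧
      run (wheelGraph (m + 3)) w (fun _ => 2) = c := by
  have h2 : IsStable (wheelGraph (m + 3)) (fun _ : Fin (m + 3) => 2) :=
    isStable_wheelGraph.2 fun _ => by simp
  obtain ⟨w, hw, hrun⟩ := exists_run_fires (fun _ => 2) c
  refine ⟨w, hw, IsStabilisation.unique (fun i _ => (isDissipative_fullInstr (m := m) i).1)
    (isStabilisation_of_fires hrun
      (isStable_run (fun l hl => isDissipative_of_mem_asmLetters (hw l hl)) h2))
    (isStabilisation_of_fires ?_ hs)⟩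
  have hburn := hc.fires
  have heq : (fun _ => 2) + c = (c + fun _ => 1) + fun _ => 1 := by
    funext i
    simp only [Pi.add_apply]
    omega
  rw [heq]
  exact (Fires.reflTransGen_add_right hburn _).trans hburn

/-- A step of the stochastic model that ends in the configuration with one grain at each vertex. -/
theorem exists_next_eq_one : ∃ (l : Letter (m + 3)) (c : Fin (m + 3) → ℕ),
    IsDissipative (wheelGraph (m + 3)) l.2 ∧ IsStable (wheelGraph (m + 3)) c ∧ Burnable c ∧
      next (wheelGraph (m + 3)) l c = fun _ => 1 := by
  have h10 : (1 : Fin (m + 3)) ≠ 0 := by simp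
  have hA : IsDissipative (wheelGraph (m + 3))
      (fun i => if i = 0 then {none, some 1} else {none}) := by
    intro i
    rw [neighborFinset_wheelGraph]
    dsimp only
    constructor
    · split_ifs with h
      · subst h
        simp [insert_subset_iff]
      · simp
    · split_ifs <;> simp
  -- Start from $(2,0,1,\dots,1)$ and add a grain at vertex `0`. Its single toppling serves only the
  -- sink and vertex `1`, leaving one grain at each; the other instructions are never used.
  refine ⟨(0, fun i => if i = 0 then {none, some 1} else {none}),
    fun i => if i = 0 then 2 else if i = 1 then 0 else 1, hA, ?_, ?_, ?_⟩
  · rw [isStable_wheelGraph]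
    intro i
    split_ifs <;> omega
  · refine ZerosSeparated.burnable (fun i j hi hj => ?_) ⟨0, by simp⟩
    have hz : ∀ i : Fin (m + 3), (if i = 0 then 2 else if i = 1 then 0 else 1) = 0 → i = 1 := by
      intro i h
      split_ifs at h with h0 h1
      exact h1
    rw [hz i hi, hz j hj]
    exact ⟨0, by simp [openArc], by simp⟩
  · refine stabilise_eq (fun i _ => (hA i).1) ⟨_, .single ⟨0, ?_, Prod.ext ?_ rfl⟩, ?_⟩
    · simp [degree_wheelGraph]
    · funext j
      simp only [sendGrains, if_true]
      by_cases hj : j = 0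
      · subst hj
        simp
      · by_cases hj1 : j = 1
        · subst hj1
          simp
        · simp [hj, hj1]
    · exact isStable_wheelGraph.2 fun _ => by simp

end Wheel

end Sandpile

namespace Sandpile

open Finset Filter MeasureTheory ProbabilityTheory

/-! ### Transfer from words to the random chains. -/

section Recurrence

variable {m : ℕ}

theorem sum_lt_of_isStable {d : Fin (m + 3) → ℕ} (hd : IsStable (wheelGraph (m + 3)) d) :
    ∑ i, d i < 3 * (m + 3) := by
  have := sum_lt_sum_of_nonempty (univ_nonempty (α := Fin (m + 3)))
    fun i _ => isStable_wheelGraph.1 hd i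
  simpa [mul_comm] using this

/-- From time `T` on, the grain positions and the relevant toppling instructions are those of the
word `w`. -/
def Follows (v : ℕ → Fin (m + 3)) (I : ℕ → Fin (m + 3) → ℕ → Finset (Option (Fin (m + 3))))
    (w : List (Letter (m + 3))) (T : ℕ) : Prop :=
  ∀ s (hs : s < w.length), v (T + s) = w[s].1 ∧
    ∀ i, ∀ k < 3 * (m + 3), I (T + s) i k = w[s].2 i

theorem frequently_chain_eq {v : ℕ → Fin (m + 3)}
    {I : ℕ → Fin (m + 3) → ℕ → Finset (Option (Fin (m + 3)))}
    (hI : ∀ t i k, I t i k ⊆ (wheelGraph (m + 3)).neighborFinset (some i))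
    {w : List (Letter (m + 3))} (hw : ∀ l ∈ w, IsDissipative (wheelGraph (m + 3)) l.2)
    {c d : Fin (m + 3) → ℕ} (hst : ∀ t, IsStable (wheelGraph (m + 3)) (chain (wheelGraph (m + 3)) v I d t))
    (hvisit : ∀ d, IsStable (wheelGraph (m + 3)) d →
      ∃ s ≤ w.length, run (wheelGraph (m + 3)) (w.take s) d = c)
    (hfreq : ∃ᶠ a in atTop, Follows v I w (a * (w.length + 1))) :
    ∃ᶠ t in atTop, chain (wheelGraph (m + 3)) v I d t = c := by
  rw [frequently_atTop] at hfreq ⊢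
  intro b
  obtain ⟨a, ha, hf⟩ := hfreq b
  obtain ⟨s, hs, hrun⟩ := hvisit _ (hst (a * (w.length + 1)))
  refine ⟨a * (w.length + 1) + s, ?_, ?_⟩
  -- The period `w.length + 1` is positive even for the empty word, so block `a` starts no earlier
  -- than time `a`.
  · nlinarith
  · rw [chain_add_eq_run hI hw (fun _ => sum_lt_of_isStable) (hst _) hf hs, hrun]

/-- If the chain follows a word that ends in a set closed under the dynamics, then the
configurations visited infinitely often belong to this set. -/
theorem of_frequently_chain_eq {v : ℕ → Fin (m + 3)}
    {I : ℕ → Fin (m + 3) → ℕ → Finset (Option (Fin (m + 3)))}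
    (hI : ∀ t i k, I t i k ⊆ (wheelGraph (m + 3)).neighborFinset (some i))
    {w : List (Letter (m + 3))} (hw : ∀ l ∈ w, IsDissipative (wheelGraph (m + 3)) l.2)
    {c d : Fin (m + 3) → ℕ} (hd : IsStable (wheelGraph (m + 3)) d) (hf : Follows v I w 0)
    {P : (Fin (m + 3) → ℕ) → Prop} (hrun : P (run (wheelGraph (m + 3)) w d))
    (hmono : ∀ a b, a ≤ b → P a → P b)
    (htopple : ∀ t i k a, 3 ≤ a i → P a → P (sendGrains i (I t i k) a))
    (hfreq : ∃ᶠ t in atTop, chain (wheelGraph (m + 3)) v I d t = c) : P c := by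
  suffices ∀ t, w.length ≤ t → P (chain (wheelGraph (m + 3)) v I d t) by
    obtain ⟨t, ht, rfl⟩ := frequently_atTop.1 hfreq w.length
    exact this t ht
  intro t ht
  induction t, ht using Nat.le_induction with
  | base =>
    have := chain_add_eq_run (T := 0) hI hw (fun _ => sum_lt_of_isStable) hd hf le_rfl
    rw [zero_add, List.take_length] at this
    rw [this]
    exact hrun
  | succ t ht ih =>
    refine stabilise_induction (fun i k a ha hPa => htopple t i k a ?_ hPa)
      (hmono _ _ le_self_add ih)
    rwa [degree_wheelGraph] at ha

/-- The periodic repetition of the word `w`, with one arbitrary letter after each repetition. -/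
def periodic (w : List (Letter (m + 3))) (t : ℕ) : Letter (m + 3) :=
  w.getD (t % (w.length + 1)) (0, fullInstr m)

theorem periodic_mul_add (w : List (Letter (m + 3))) (a : ℕ) {s : ℕ} (hs : s < w.length) :
    periodic w (a * (w.length + 1) + s) = w[s] := by
  have : (a * (w.length + 1) + s) % (w.length + 1) = s := by
    rw [Nat.mul_add_mod_self_right, Nat.mod_eq_of_lt (by omega)]
  rw [periodic, this, List.getD_eq_getElem _ _ hs]

/-- The times of the `a`-th repetition of the word `w`. -/
def block (w : List (Letter (m + 3))) (a : ℕ) : Finset ℕ :=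
  Ico (a * (w.length + 1)) (a * (w.length + 1) + w.length)

theorem mem_block (w : List (Letter (m + 3))) (a : ℕ) {s : ℕ} (hs : s < w.length) :
    a * (w.length + 1) + s ∈ block w a :=
  mem_Ico.2 ⟨le_self_add, by omega⟩

theorem pairwise_disjoint_block (w : List (Letter (m + 3))) :
    Pairwise fun a b => Disjoint (block w a) (block w b) := by
  intro a b hab
  rw [Finset.disjoint_left]
  intro t hta htb
  obtain ⟨h1, h2⟩ := mem_Ico.1 hta
  obtain ⟨h3, h4⟩ := mem_Ico.1 htb
  rcases lt_or_gt_of_ne hab with h | h <;> nlinarith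

/-- The coins that may be used during the `a`-th repetition of the word `w`. -/
def coinBlock (w : List (Letter (m + 3))) (a : ℕ) :
    Finset (ℕ × Fin (m + 3) × ℕ × Option (Fin (m + 3))) :=
  block w a ×ˢ univ ×ˢ range (3 * (m + 3)) ×ˢ univ

theorem pairwise_disjoint_coinBlock (w : List (Letter (m + 3))) :
    Pairwise fun a b => Disjoint (coinBlock w a) (coinBlock w b) := fun _ _ hab =>
  disjoint_product.2 (Or.inl (pairwise_disjoint_block w hab))

/-- The coins that produce the letters of `periodic w`. -/
def periodicCoin (w : List (Letter (m + 3)))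
    (x : ℕ × Fin (m + 3) × ℕ × Option (Fin (m + 3))) : Bool :=
  decide (x.2.2.2 ∈ (periodic w x.1).2 x.2.1)

theorem follows_ssmInstr {w : List (Letter (m + 3))}
    (hw : ∀ l ∈ w, IsDissipative (wheelGraph (m + 3)) l.2) {a : ℕ} {v : ℕ → Fin (m + 3)}
    {ξ : ℕ × Fin (m + 3) × ℕ × Option (Fin (m + 3)) → Bool}
    (hv : v ∈ agreeOn (block w a) fun t => (periodic w t).1)
    (hξ : ξ ∈ agreeOn (coinBlock w a) (periodicCoin w)) :
    Follows v (ssmInstr (wheelGraph (m + 3)) ξ) w (a * (w.length + 1)) := by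
  intro s hs
  have hmem := mem_block w a hs
  refine ⟨?_, fun i k hk => ?_⟩
  · rw [mem_agreeOn.1 hv _ hmem, periodic_mul_add w a hs]
  · ext j
    have hj : ξ (a * (w.length + 1) + s, i, k, j) = decide (j ∈ w[s].2 i) := by
      rw [mem_agreeOn.1 hξ _ (by simp [coinBlock, hmem, hk]), periodicCoin,
        periodic_mul_add w a hs]
    rw [ssmInstr, mem_filter, hj, decide_eq_true_iff, and_iff_right_of_imp]
    exact fun h => (hw _ (List.getElem_mem hs) i).1 h

theorem follows_asmInstr {w : List (Letter (m + 3))} (hw : ∀ l ∈ w, l ∈ asmLetters m) {a : ℕ}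
    {v : ℕ → Fin (m + 3)} (hv : v ∈ agreeOn (block w a) fun t => (periodic w t).1) :
    Follows v (asmInstr (wheelGraph (m + 3))) w (a * (w.length + 1)) := by
  intro s hs
  refine ⟨?_, fun i k _ => ?_⟩
  · rw [mem_agreeOn.1 hv _ (mem_block w a hs), periodic_mul_add w a hs]
  · rw [show w[s].2 = fullInstr m from hw _ (List.getElem_mem hs)]
    rfl

theorem ssmInstr_subset (ξ : ℕ × Fin (m + 3) × ℕ × Option (Fin (m + 3)) → Bool) (t : ℕ)
    (i : Fin (m + 3)) (k : ℕ) : ssmInstr (wheelGraph (m + 3)) ξ t i k ⊆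
      (wheelGraph (m + 3)).neighborFinset (some i) :=
  filter_subset _ _

theorem isStable_chain {v : ℕ → Fin (m + 3)}
    {I : ℕ → Fin (m + 3) → ℕ → Finset (Option (Fin (m + 3)))}
    (hI : ∀ t i k, I t i k ⊆ (wheelGraph (m + 3)).neighborFinset (some i))
    (hsink : ∀ t i, ∃ᶠ k in atTop, none ∈ I t i k) {c : Fin (m + 3) → ℕ}
    (hc : IsStable (wheelGraph (m + 3)) c) (t : ℕ) :
    IsStable (wheelGraph (m + 3)) (chain (wheelGraph (m + 3)) v I c t) := by
  cases t with
  | zero => exact hc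
  | succ t =>
    exact isStable_stabilise (exists_isStabilisation_of_frequently (hI t) (hsink t) _)

theorem exists_pos_le_toMeasure (μ : PMF (Fin (m + 3))) (hμ : ∀ i, 0 < μ i) :
    ∃ q : ENNReal, q ≠ 0 ∧ ∀ i, q ≤ μ.toMeasure {i} := by
  obtain ⟨i, hi⟩ := Finite.exists_min μ
  refine ⟨μ i, (hμ i).ne', fun j => ?_⟩
  rw [PMF.toMeasure_apply_singleton _ _ (measurableSet_singleton j)]
  exact hi j

theorem exists_pos_le_bernoulliMeasure {p : unitInterval} (hp0 : 0 < p) (hp1 : p < 1) :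
    ∃ q : ENNReal, q ≠ 0 ∧ ∀ b : Bool, q ≤ bernoulliMeasure true false p {b} := by
  refine ⟨min (bernoulliMeasure true false p {true}) (bernoulliMeasure true false p {false}),
    ?_, fun b => ?_⟩
  · have h0 : bernoulliMeasure true false p {true} ≠ 0 := by
      rw [bernoulliMeasure_apply_of_mem_of_notMem p (measurableSet_singleton _) (by simp)
        (by simp)]
      rw [Ne, ENNReal.coe_eq_zero]
      exact fun h => hp0.ne' (Subtype.ext (congrArg NNReal.toReal h))
    have h1 : bernoulliMeasure true false p {false} ≠ 0 := by
      rw [bernoulliMeasure_apply_of_notMem_of_mem p (measurableSet_singleton _) (by simp)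
        (by simp)]
      rw [Ne, ENNReal.coe_eq_zero]
      exact fun h => hp1.ne
        (unitInterval.symm_eq_zero.1 (Subtype.ext (congrArg NNReal.toReal h)))
    exact (lt_min (pos_iff_ne_zero.2 h0) (pos_iff_ne_zero.2 h1)).ne'
  · cases b
    · exact min_le_right _ _
    · exact min_le_left _ _

/-- Serves to pick one sample path that begins by following a given word and also returns to `c`
infinitely often. -/
theorem exists_mem_of_ae {Ω : Type*} [MeasurableSpace Ω] {P : Measure Ω} {s : Set Ω}
    (hs : P s ≠ 0) {Q : Ω → Prop} (h : ∀ᵐ ω ∂P, Q ω) : ∃ ω ∈ s, Q ω := by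
  by_contra! hne
  exact hs (measure_mono_null hne (ae_iff.1 h))

/-! ### Characterisation of the recurrent configurations. -/

variable {μ : PMF (Fin (m + 3))} {p : unitInterval} {c : Fin (m + 3) → ℕ}

/-- Almost surely, every vertex may send grains to the sink infinitely often. -/
theorem ae_frequently_coin (hp0 : 0 < p) (hp1 : p < 1) :
    ∀ᵐ ξ ∂coinLaw (m + 3) p, ∀ t i, ∃ᶠ k in atTop, ξ (t, i, k, none) = true := by
  obtain ⟨q, hq0, hq⟩ := exists_pos_le_bernoulliMeasure hp0 hp1
  rw [ae_all_iff]
  intro t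
  rw [ae_all_iff]
  intro i
  have := ae_frequently_agreeOn
    (ν := fun _ : ℕ × Fin (m + 3) × ℕ × Option (Fin (m + 3)) => bernoulliMeasure true false p)
    (F := fun k => {(t, i, k, none)}) (fun a b hab => by simpa using hab)
    (fun _ => card_singleton _) (w := fun _ => true) hq0 fun _ => hq _
  filter_upwards [this] with ξ hξ
  exact hξ.mono fun k hk => by simpa using mem_agreeOn.1 hk _ (mem_singleton_self _)

/-- Every stable configuration climbs to $(2,\dots,2)$ and from there reaches `c` by `w`. A common
visiting word therefore exists, and almost surely it is followed in infinitely many blocks. -/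
theorem mem_SSMRec_of_word (hμ : ∀ i, 0 < μ i) (hp0 : 0 < p) (hp1 : p < 1)
    (hc : IsStable (wheelGraph (m + 3)) c) {w : List (Letter (m + 3))}
    (hw : ∀ l ∈ w, IsDissipative (wheelGraph (m + 3)) l.2)
    (hrun : run (wheelGraph (m + 3)) w (fun _ => 2) = c) :
    c ∈ SSMRec (wheelGraph (m + 3)) μ p := by
  refine ⟨hc, ?_⟩
  obtain ⟨u, hu, hvisit⟩ := exists_visiting_word
    (Λ := {l | IsDissipative (wheelGraph (m + 3)) l.2}) (fun _ h => h) (c := c) fun d hd => by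
      obtain ⟨w', hw', hrun'⟩ := exists_run_eq_two hd
      refine ⟨w' ++ w, fun l hl => ?_, by rw [run_append, hrun', hrun]⟩
      rcases List.mem_append.1 hl with hl | hl
      · exact isDissipative_of_mem_asmLetters (hw' l hl)
      · exact hw l hl
  obtain ⟨q, hq0, hq⟩ := exists_pos_le_toMeasure μ hμ
  obtain ⟨q', hq0', hq'⟩ := exists_pos_le_bernoulliMeasure hp0 hp1
  have hword := ae_frequently_agreeOn_prod
    (ν := fun _ : ℕ => μ.toMeasure)
    (ρ := fun _ : ℕ × Fin (m + 3) × ℕ × Option (Fin (m + 3)) => bernoulliMeasure true false p)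
    (pairwise_disjoint_block u) (N := u.length) (fun a => by simp [block])
    (w := fun t => (periodic u t).1) hq0 (fun _ => hq _)
    (pairwise_disjoint_coinBlock u)
    -- Coins per block: times, toppling vertices, topplings of each, and possible receivers
    -- including the sink.
    (N' := u.length * ((m + 3) * (3 * (m + 3) * (m + 4)))) (fun a => by simp [coinBlock, block])
    (w' := periodicCoin u) hq0' (fun _ => hq' _)
  have hcoin : ∀ᵐ ω ∂(grainLaw μ).prod (coinLaw (m + 3) p),
      ∀ t i, ∃ᶠ k in atTop, ω.2 (t, i, k, none) = true :=
    have : IsProbabilityMeasure (grainLaw μ) := by unfold grainLaw; infer_instance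
    have : IsProbabilityMeasure (coinLaw (m + 3) p) := by unfold coinLaw; infer_instance
    Measure.quasiMeasurePreserving_snd.ae (ae_frequently_coin hp0 hp1)
  filter_upwards [hword, hcoin] with ω hω hsink
  refine frequently_chain_eq (ssmInstr_subset ω.2) hu
    (isStable_chain (ssmInstr_subset ω.2) (fun t i => (hsink t i).mono fun k hk => ?_) hc)
    hvisit (hω.mono fun a ha => follows_ssmInstr hu ha.1 ha.2)
  rw [ssmInstr, mem_filter, neighborFinset_wheelGraph]
  exact ⟨by simp, hk⟩

theorem mem_ASMRec_of_burnable (hμ : ∀ i, 0 < μ i)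
    (hc : IsStable (wheelGraph (m + 3)) c) (hb : Burnable c) :
    c ∈ ASMRec (wheelGraph (m + 3)) μ := by
  refine ⟨hc, ?_⟩
  obtain ⟨w, hw, hrun⟩ := hb.exists_run_two_eq hc
  obtain ⟨u, hu, hvisit⟩ := exists_visiting_word
    (fun _ => isDissipative_of_mem_asmLetters) (c := c) fun d hd => by
      obtain ⟨w', hw', hrun'⟩ := exists_run_eq_two hd
      refine ⟨w' ++ w, fun l hl => ?_, by rw [run_append, hrun', hrun]⟩
      exact (List.mem_append.1 hl).elim (hw' l) (hw l)
  obtain ⟨q, hq0, hq⟩ := exists_pos_le_toMeasure μ hμ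
  have hword := ae_frequently_agreeOn (ν := fun _ : ℕ => μ.toMeasure)
    (pairwise_disjoint_block u) (N := u.length) (fun a => by simp [block])
    (w := fun t => (periodic u t).1) hq0 (fun _ => hq _)
  have hI : ∀ t i k, asmInstr (wheelGraph (m + 3)) t i k ⊆
    (wheelGraph (m + 3)).neighborFinset (some i) := fun _ _ _ => subset_rfl
  filter_upwards [hword] with v hv
  exact frequently_chain_eq hI (fun l hl => isDissipative_of_mem_asmLetters (hu l hl))
    (isStable_chain hI (fun t i => Frequently.of_forall fun k =>
      (isDissipative_fullInstr (m := m) i).2) hc)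
    hvisit (hv.mono fun a ha => follows_asmInstr hu ha)

/-- With positive probability the chain from `c` begins by climbing to $(2,\dots,2)$. The invariant
holds from then on, hence also at a later return to `c`. -/
theorem oriented_of_mem_SSMRec (hμ : ∀ i, 0 < μ i) (hp0 : 0 < p) (hp1 : p < 1)
    (hc : c ∈ SSMRec (wheelGraph (m + 3)) μ p) : Oriented c := by
  obtain ⟨hs, hae⟩ := hc
  obtain ⟨w, hw, hrun⟩ := exists_run_eq_two hs
  have hw' := fun l hl => isDissipative_of_mem_asmLetters (hw l hl)
  obtain ⟨q, hq0, hq⟩ := exists_pos_le_toMeasure μ hμ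
  obtain ⟨q', hq0', hq'⟩ := exists_pos_le_bernoulliMeasure hp0 hp1
  have hpos : ((grainLaw μ).prod (coinLaw (m + 3) p))
      (agreeOn (block w 0) (fun t => (periodic w t).1) ×ˢ
        agreeOn (coinBlock w 0) (periodicCoin w)) ≠ 0 := by
    have : SFinite (coinLaw (m + 3) p) := by unfold coinLaw; infer_instance
    rw [Measure.prod_prod]
    refine mul_ne_zero
      (ne_bot_of_le_ne_bot (pow_ne_zero _ hq0)
        (pow_le_infinitePi_agreeOn (fun _ => hq _) (block w 0)))
      (ne_bot_of_le_ne_bot (pow_ne_zero _ hq0')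
        (pow_le_infinitePi_agreeOn (fun _ => hq' _) (coinBlock w 0)))
  obtain ⟨ω, hω, hfreq⟩ := exists_mem_of_ae hpos hae
  have hf := follows_ssmInstr hw' hω.1 hω.2
  rw [zero_mul] at hf
  exact of_frequently_chain_eq (ssmInstr_subset ω.2) hw' hs hf (hrun ▸ oriented_two)
    (fun _ _ hab h => h.mono hab) (fun t i k _ ha h => h.sendGrains (ssmInstr_subset ω.2 t i k) ha)
    hfreq

theorem oriented_and_burnable_of_mem_ASMRec (hμ : ∀ i, 0 < μ i)
    (hc : c ∈ ASMRec (wheelGraph (m + 3)) μ) : Oriented c ∧ Burnable c := by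
  obtain ⟨hs, hae⟩ := hc
  obtain ⟨w, hw, hrun⟩ := exists_run_eq_two hs
  obtain ⟨q, hq0, hq⟩ := exists_pos_le_toMeasure μ hμ
  have hpos : grainLaw μ (agreeOn (block w 0) fun t => (periodic w t).1) ≠ 0 :=
    ne_bot_of_le_ne_bot (pow_ne_zero _ hq0)
      (pow_le_infinitePi_agreeOn (fun _ => hq _) (block w 0))
  obtain ⟨v, hv, hfreq⟩ := exists_mem_of_ae hpos hae
  have hf := follows_asmInstr hw hv
  rw [zero_mul] at hf
  exact of_frequently_chain_eq (P := fun c => Oriented c ∧ Burnable c)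
    (fun _ _ _ => subset_rfl) (fun l hl => isDissipative_of_mem_asmLetters (hw l hl)) hs hf
    (hrun ▸ ⟨oriented_two, burnable_two⟩) (fun _ _ hab h => ⟨h.1.mono hab, h.2.mono hab⟩)
    (fun t i k _ ha h => ⟨h.1.sendGrains subset_rfl ha, h.2.sendGrains i⟩) hfreq

/-- Even a single zero forces a 2, by the case `i = j` of separation. -/
theorem ZerosSeparated.exists_eq_two_or_eq_one (hz : ZerosSeparated c) (hs : ∀ i, c i < 3) :
    (∃ i, c i = 2) ∨ c = fun _ => 1 := by
  by_contra! hne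
  refine hne.2 (funext fun i => ?_)
  have h0 : c i ≠ 0 := fun h0 => by
    obtain ⟨k, -, hk⟩ := hz i i h0 h0
    exact hne.1 k hk
  have := hs i
  have := hne.1 i
  omega

theorem mem_SSMRec_iff (hμ : ∀ i, 0 < μ i) (hp0 : 0 < p) (hp1 : p < 1) :
    c ∈ SSMRec (wheelGraph (m + 3)) μ p ↔ (∀ i, c i < 3) ∧ ZerosSeparated c := by
  rw [← isStable_wheelGraph]
  constructor
  · exact fun hc => ⟨hc.1, (oriented_of_mem_SSMRec hμ hp0 hp1 hc).zerosSeparated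
      (isStable_wheelGraph.1 hc.1)⟩
  · rintro ⟨hs, hz⟩
    rcases hz.exists_eq_two_or_eq_one (isStable_wheelGraph.1 hs) with h2 | rfl
    · obtain ⟨w, hw, hrun⟩ := (hz.burnable h2).exists_run_two_eq hs
      exact mem_SSMRec_of_word hμ hp0 hp1 hs
        (fun l hl => isDissipative_of_mem_asmLetters (hw l hl)) hrun
    · obtain ⟨l, d, hl, hd, hb, hld⟩ := exists_next_eq_one (m := m)
      obtain ⟨w, hw, hrun⟩ := hb.exists_run_two_eq hd
      refine mem_SSMRec_of_word hμ hp0 hp1 hs (w := w ++ [l]) (fun l' hl' => ?_) ?_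
      · rcases List.mem_append.1 hl' with h | h
        · exact isDissipative_of_mem_asmLetters (hw l' h)
        · rwa [List.mem_singleton.1 h]
      · rw [run_append, hrun]
        exact hld

theorem mem_ASMRec_iff (hμ : ∀ i, 0 < μ i) :
    c ∈ ASMRec (wheelGraph (m + 3)) μ ↔
      ((∀ i, c i < 3) ∧ ZerosSeparated c) ∧ ∃ i, c i = 2 := by
  constructor
  · intro hc
    have hs := isStable_wheelGraph.1 hc.1
    obtain ⟨ho, hb⟩ := oriented_and_burnable_of_mem_ASMRec hμ hc
    exact ⟨⟨hs, ho.zerosSeparated hs⟩, hb.exists_eq_two hs⟩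
  · rintro ⟨⟨hs, hz⟩, h2⟩
    exact mem_ASMRec_of_burnable hμ (isStable_wheelGraph.2 hs) (hz.burnable h2)

end Recurrence

end Sandpile

theorem theorem3p2 (n : ℕ) (hn : 3 ≤ n) (μ : PMF (Fin n)) (hμ : ∀ i, 0 < μ i)
    (p : unitInterval) (hp0 : 0 < p) (hp1 : p < 1) :
    (∀ c : Fin n → ℕ, (∀ i, c i ∈ ({0, 1, 2} : Set ℕ)) →
      (c ∈ Sandpile.SSMRec (Sandpile.wheelGraph n) μ p ↔
        ∀ i j, c i = 0 → c j = 0 → ∃ k ∈ Sandpile.openArc i j, c k = 2) ∧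
      (c ∈ Sandpile.ASMRec (Sandpile.wheelGraph n) μ ↔
        c ∈ Sandpile.SSMRec (Sandpile.wheelGraph n) μ p ∧ ∃ i, c i = 2)) ∧
    Sandpile.SSMRec (Sandpile.wheelGraph n) μ p =
      Sandpile.ASMRec (Sandpile.wheelGraph n) μ ∪ {fun _ => 1} := by
  obtain ⟨m, rfl⟩ : ∃ m, n = m + 3 := ⟨n - 3, by omega⟩
  refine ⟨fun c hc => ?_, ?_⟩
  · rw [Sandpile.mem_ASMRec_iff hμ, Sandpile.mem_SSMRec_iff hμ hp0 hp1]
    refine ⟨and_iff_right fun i => ?_, Iff.rfl⟩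
    have := hc i
    simp only [Set.mem_insert_iff, Set.mem_singleton_iff] at this
    omega
  · ext c
    rw [Set.mem_union, Set.mem_singleton_iff, Sandpile.mem_ASMRec_iff hμ,
      Sandpile.mem_SSMRec_iff hμ hp0 hp1]
    constructor
    · intro h
      exact (h.2.exists_eq_two_or_eq_one h.1).imp_left fun h2 => ⟨h, h2⟩
    · rintro (h | rfl)
      · exact h.1
      · exact ⟨fun _ => by simp, fun _ _ h => absurd h (by simp)⟩
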